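/- Let $P$ and $Q$ be lattice paths from $(0,0)$ to $(m,r)$ with steps $E=(1,0)$ and $N=(0,1)$, with $P$ never going above $Q$, and put $n=m+r$. Let $l_1<\dots<l_r$ and $u_1<\dots<u_r$ be the positions of the North steps of $Q$ and of $P$. The lattice path matroid $M[P,Q]$ is the transversal matroid on $\{1,\dots,n\}$ with presentation $([l_j,u_j])_{1\le j\le r}$ (its independent sets are the partial transversals), and its polytope $\mathcal P(M[P,Q])\subset\mathbb R^n$ is the convex hull of the incidence vectors of its bases. Suppose that $M[P,Q]$ is connected (it has exactly one connected component, where two elements of the ground set are in the same component if they are equal or lie in a common circuit), and that it is not a border strip matroid, i.e. the region between $P$ and $Q$, regarded as a set of unit boxes, is not a border strip. (A border strip is a set of boxes that is connected through shared edges and contains no $2\times2$ block; the empty set counts as one.) Then $$\operatorname{Vol}\,\mathcal P(M[P,Q])=\sum_{p} f_{S(p)} .$$ Here $\operatorname{Vol}$ is the normalized volume: $(n-1)!$ times the Lebesgue measure of the image of the polytope under the projection $\mathbb R^n\to\mathbb R^{n-1}$ that forgets the last coordinate, so that a unit simplex has volume $1$. The sum is over all paths $p$ that go from the first box $[0,1]\times[0,1]$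 to the last box $[m-1,m]\times[r-1,r]$, each step leading to the box adjacent on the right or above, and all of whose boxes lie between $P$ and $Q$. $S(p)$ is the border strip formed by the $n-1$ boxes of $p$. Finally, $f_{S(p)}$ is the number of standard Young tableaux of shape $S(p)$: the bijective fillings of its boxes by $1,\dots,n-1$ that increase from left to right along rows and decrease from bottom to top along columns. -/

import Mathlib

namespace LPM

/-! ### Transversal matroids -/

/-- `I` is a partial transversal of the set system `(A j)_{j : ι}`: its elements can be matched
injectively to indices `j` with `x ∈ A j`. -/
def IsPartialTransversal {α ι : Type*} (A : ι → Set α) (I : Set α) : Prop :=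
  ∃ f : I → ι, Function.Injective f ∧ ∀ x : I, (x : α) ∈ A (f x)

theorem isPartialTransversal_iff {α ι : Type*} [Nonempty ι] (A : ι → Set α) (I : Set α) :
    IsPartialTransversal A I ↔ ∃ f : α → ι, Set.InjOn f I ∧ ∀ x ∈ I, x ∈ A (f x) := by
  classical
  constructor
  · rintro ⟨f, hf, hA⟩
    refine ⟨fun x => if h : x ∈ I then f ⟨x, h⟩ else Classical.arbitrary ι, ?_, ?_⟩
    · intro x hx y hy hxy
      simp only [hx, hy, dif_pos] at hxy
      exact congrArg Subtype.val (hf hxy)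
    · intro x hx
      simpa only [hx, dif_pos] using hA ⟨x, hx⟩
  · rintro ⟨f, hf, hA⟩
    exact ⟨fun x => f x, fun x y hxy => Subtype.ext (hf x.2 y.2 hxy), fun x => hA x x.2⟩

/-- Augmentation for partial transversals; the induction is on the number `n` of common elements
on which the two matchings disagree. -/
theorem augment_aux {α ι : Type*} [Finite α] (A : ι → Set α) (I J : Set α)
    (g : α → ι) (hg : Set.InjOn g J) (hgA : ∀ x ∈ J, x ∈ A (g x)) (hIJ : I.ncard < J.ncard)
    (n : ℕ) : ∀ f : α → ι, Set.InjOn f I → (∀ x ∈ I, x ∈ A (f x)) →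
      {y | y ∈ I ∧ y ∈ J ∧ f y ≠ g y}.ncard = n →
      ∃ e ∈ J, e ∉ I ∧ ∃ h : α → ι, Set.InjOn h (insert e I) ∧ ∀ x ∈ insert e I, x ∈ A (h x) := by
  classical
  induction n using Nat.strong_induction_on with
  | _ n ih =>
    intro f hf hfA hn
    have hlt : (f '' I).ncard < (g '' J).ncard := by
      rwa [hf.ncard_image, hg.ncard_image]
    obtain ⟨j, ⟨x, hxJ, rfl⟩, hj⟩ := Set.exists_mem_notMem_of_ncard_lt_ncard hlt
      ((Set.toFinite I).image f)
    have hne : ∀ y ∈ I, f y ≠ g x := fun y hy h => hj ⟨y, hy, h⟩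
    have hinj : Set.InjOn (Function.update f x (g x)) (insert x I) := by
      intro a ha b hb hab
      by_cases hax : a = x <;> by_cases hbx : b = x
      · rw [hax, hbx]
      · subst hax
        rw [Function.update_self, Function.update_of_ne hbx] at hab
        exact absurd hab.symm (hne b (hb.resolve_left hbx))
      · subst hbx
        rw [Function.update_self, Function.update_of_ne hax] at hab
        exact absurd hab (hne a (ha.resolve_left hax))
      · rw [Function.update_of_ne hax, Function.update_of_ne hbx] at hab
        exact hf (ha.resolve_left hax) (hb.resolve_left hbx) hab
    have hmem : ∀ y ∈ insert x I, y ∈ A (Function.update f x (g x) y) := by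
      intro y hy
      by_cases hyx : y = x
      · subst hyx
        rw [Function.update_self]
        exact hgA y hxJ
      · rw [Function.update_of_ne hyx]
        exact hfA y (hy.resolve_left hyx)
    by_cases hxI : x ∈ I
    · refine ih _ ?_ (Function.update f x (g x)) (hinj.mono (Set.subset_insert x I))
        (fun y hy => hmem y (Set.mem_insert_of_mem x hy)) rfl
      rw [← hn]
      apply Set.ncard_lt_ncard _ (Set.toFinite _)
      refine ⟨?_, ?_⟩
      · rintro y ⟨hyI, hyJ, hy⟩
        by_cases hyx : y = x
        · subst hyx
          simp at hy
        · rw [Function.update_of_ne hyx] at hy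
          exact ⟨hyI, hyJ, hy⟩
      · intro h
        have := (h (show x ∈ _ from ⟨hxI, hxJ, hne x hxI⟩)).2.2
        simp at this
    · exact ⟨x, hxJ, hxI, _, hinj, hmem⟩

/-- The transversal matroid on the finite set `α` with presentation `A`: its independent sets are
the partial transversals of `A`. -/
def transversalMatroid {α ι : Type*} [Finite α] (A : ι → Set α) : Matroid α :=
  (IndepMatroid.ofFinite (E := Set.univ) Set.finite_univ (IsPartialTransversal A)
    ⟨fun x => x.2.elim, fun x => x.2.elim, fun x => x.2.elim⟩
    (by
      rintro I J ⟨f, hf, hA⟩ hIJ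
      exact ⟨fun x => f ⟨x, hIJ x.2⟩,
        fun _ _ hxy => Subtype.ext (Subtype.mk.inj (hf hxy)), fun x => hA ⟨x, hIJ x.2⟩⟩)
    (by
      intro I J hI hJ hIJ
      have hne : J.Nonempty := by
        rw [Set.nonempty_iff_ne_empty]
        rintro rfl
        simp at hIJ
      obtain ⟨g₀, -, -⟩ := id hJ
      have : Nonempty ι := ⟨g₀ ⟨_, hne.some_mem⟩⟩
      rw [isPartialTransversal_iff] at hI hJ
      obtain ⟨f, hf, hfA⟩ := hI
      obtain ⟨g, hg, hgA⟩ := hJ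
      obtain ⟨e, he, he', h⟩ := augment_aux A I J g hg hgA hIJ _ f hf hfA rfl
      exact ⟨e, he, he', (isPartialTransversal_iff A _).2 h⟩)
    (fun _ _ => Set.subset_univ _)).matroid

/-- A matroid is connected if it has exactly one connected component, the components being the
classes of the relation "equal, or contained in a common circuit" on the ground set. -/
def IsConnected {α : Type*} (M : Matroid α) : Prop :=
  M.E.Nonempty ∧ ∀ x ∈ M.E, ∀ y ∈ M.E, x = y ∨ ∃ C, M.IsCircuit C ∧ x ∈ C ∧ y ∈ C

/-- The matroid polytope: the convex hull of the incidence vectors of the bases. -/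
def matroidPolytope {α : Type*} (M : Matroid α) : Set (α → ℝ) :=
  convexHull ℝ {x | ∃ B, M.IsBase B ∧ x = Set.indicator B 1}

/-! ### Lattice paths -/

inductive Step
  | E
  | N
  deriving DecidableEq

instance : Fintype Step := ⟨{Step.E, Step.N}, fun s => by cases s <;> simp⟩

/-- Lattice paths from `(0,0)` to `(m,r)` with steps `E = (1,0)` and `N = (0,1)`, as words of
length `m + r` with exactly `r` letters `N`. -/
def LatticePath (m r : ℕ) : Type :=
  {w : Fin (m + r) → Step // (Finset.univ.filter fun k => w k = Step.N).card = r}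

instance (m r : ℕ) : Fintype (LatticePath m r) :=
  inferInstanceAs (Fintype
    {w : Fin (m + r) → Step // (Finset.univ.filter fun k => w k = Step.N).card = r})

namespace LatticePath

variable {m r : ℕ}

/-- The number of letters `s` among the first `i` letters of the path. -/
def count (P : LatticePath m r) (s : Step) (i : ℕ) : ℕ :=
  (Finset.univ.filter fun k : Fin (m + r) => (k : ℕ) < i ∧ P.1 k = s).card

/-- The position of the path after its first `i` steps. -/
def vertex (P : LatticePath m r) (i : ℕ) : ℕ × ℕ :=
  (P.count Step.E i, P.count Step.N i)

/-- `P` never goes above `Q`. -/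
def NeverAbove (P Q : LatticePath m r) : Prop :=
  ∀ i ≤ m + r, P.count Step.N i ≤ Q.count Step.N i

/-- The position (in the word, numbered from `0`) of the `j`-th North step, `j : Fin r`. -/
def northStep (P : LatticePath m r) (j : Fin r) : Fin (m + r) :=
  (Finset.univ.filter fun k => P.1 k = Step.N).orderEmbOfFin P.2 j

end LatticePath

open LatticePath

/-- The lattice path matroid `M[P,Q]`: the transversal matroid on the set of the `m + r` positions
with presentation `N_j = [l_j, u_j]`, where `l_j` and `u_j` are the positions of the `j`-th North
steps of `Q` and of `P`. -/
def latticePathMatroid {m r : ℕ} (P Q : LatticePath m r) : Matroid (Fin (m + r)) :=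
  transversalMatroid fun j : Fin r => Set.Icc (Q.northStep j) (P.northStep j)

/-! ### The region between two paths, border strips

The unit box `[a, a+1] × [b, b+1]` is denoted by its lower left corner `(a, b)`. -/

/-- The lattice point `v` lies weakly between `P` and `Q`: it is weakly above the point of `P` and
weakly below the point of `Q` on the same antidiagonal. -/
def PointBetween {m r : ℕ} (P Q : LatticePath m r) (v : ℕ × ℕ) : Prop :=
  v.1 + v.2 ≤ m + r ∧ P.count Step.N (v.1 + v.2) ≤ v.2 ∧ v.2 ≤ Q.count Step.N (v.1 + v.2)

/-- The boxes of the region between `P` and `Q`: those all of whose corners lie weakly between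
`P` and `Q`. -/
def region {m r : ℕ} (P Q : LatticePath m r) : Set (ℕ × ℕ) :=
  {c | PointBetween P Q c ∧ PointBetween P Q (c.1 + 1, c.2) ∧
    PointBetween P Q (c.1, c.2 + 1) ∧ PointBetween P Q (c.1 + 1, c.2 + 1)}

/-- Two boxes are adjacent if they share an edge. -/
def boxGraph : SimpleGraph (ℕ × ℕ) :=
  SimpleGraph.fromRel fun c d => d = (c.1 + 1, c.2) ∨ d = (c.1, c.2 + 1)

/-- A (skew) diagram is a border strip if any two of its boxes are joined by a chain of adjacent
boxes and it contains no `2 × 2` block. The empty diagram is a border strip. -/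
def IsBorderStrip (S : Set (ℕ × ℕ)) : Prop :=
  (boxGraph.induce S).Preconnected ∧
    ¬ ∃ a b, (a, b) ∈ S ∧ (a + 1, b) ∈ S ∧ (a, b + 1) ∈ S ∧ (a + 1, b + 1) ∈ S

/-- `M[P,Q]` is a border strip matroid: it is connected and the region between `P` and `Q` is a
border strip. -/
def IsBorderStripMatroid {m r : ℕ} (P Q : LatticePath m r) : Prop :=
  IsConnected (latticePathMatroid P Q) ∧ IsBorderStrip (region P Q)

/-- The border strip `S(p)`: the boxes visited by a path `p` that walks through boxes, from the
box `(0,0)` to the box `(a,b)`. It has `a + b + 1` boxes. -/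
def strip {a b : ℕ} (p : LatticePath a b) : Finset (ℕ × ℕ) :=
  (Finset.range (a + b + 1)).image p.vertex

open Classical in
/-- The paths contained in the region between `P` and `Q`: paths of boxes from the first box
`(0,0)` to the last box `(m-1,r-1)` of the `m × r` rectangle, all of whose boxes are in the
region. (If `m = 0` or `r = 0` the region has no boxes and the set is empty.) -/
noncomputable def pathsInRegion {m r : ℕ} (P Q : LatticePath m r) :
    Finset (LatticePath (m - 1) (r - 1)) :=
  Finset.univ.filter fun p => ∀ c ∈ strip p, c ∈ region P Q

/-- A standard Young tableau of shape `S`: a bijective filling of the boxes of `S` by the numbers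
`1, …, |S|`, increasing from left to right in every row and decreasing upwards in every column
(the second coordinate of a box points upwards). -/
def IsStandardTableau (S : Finset (ℕ × ℕ)) (T : S → ℕ) : Prop :=
  Set.BijOn T Set.univ (Set.Icc 1 S.card) ∧
    (∀ c d : S, c.1.2 = d.1.2 → c.1.1 < d.1.1 → T c < T d) ∧
    (∀ c d : S, c.1.1 = d.1.1 → c.1.2 < d.1.2 → T d < T c)

/-- `f_S`, the number of standard Young tableaux of shape `S`. -/
noncomputable def numTableaux (S : Finset (ℕ × ℕ)) : ℕ :=
  {T : S → ℕ | IsStandardTableau S T}.ncard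

/-! ### Normalized volume -/

/-- The projection `ℝⁿ → ℝⁿ⁻¹` that forgets the last coordinate. -/
def forgetLast {n : ℕ} (x : Fin n → ℝ) : Fin (n - 1) → ℝ :=
  fun i => x (Fin.castLE (Nat.sub_le n 1) i)

/-- The normalized volume of a set contained in a hyperplane `x₁ + ⋯ + xₙ = const` of `ℝⁿ`: the
Lebesgue measure of its projection to `ℝⁿ⁻¹`, scaled so that the unit simplex has volume `1` and
the unit cube has volume `(n-1)!`. -/
noncomputable def normalizedVolume {n : ℕ} (S : Set (Fin n → ℝ)) : ENNReal :=
  (n - 1).factorial * MeasureTheory.volume (forgetLast '' S)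

end LPM

namespace LPM

open LatticePath MeasureTheory

/-! Pass from a point x to its partial sums Y_i = x_1 + ⋯ + x_i. Bases are exactly the North step
sets of paths between P and Q (`latticePathMatroid_isBase_iff`), and the polytope is cut out by 0 ≤
x_k ≤ 1 and by the requirement that Y_i lie between the heights of P and Q at i
(`matroidPolytope_latticePathMatroid`). For the harder inclusion, rounding all Y_i with one common
threshold s in [0,1) gives a base, and the average of these vertices over s is x.

The map to partial sums is unimodular, so the volume may be computed for the sequences Y_1, …,
Y_{n-1}. For a generic sequence the integer parts of Y_1, …, Y_{n-1} rise by 0 or 1 from 0 to r - 1,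
hence are the heights of a path p of boxes; the bounds by P and Q say that the boxes lie in the
region. The condition 0 ≤ Y_{k+1} - Y_k ≤ 1 then says that the fractional part goes up along an East
step and down along a North step. Up to null sets the polytope is thus a disjoint union, over p, of
translated order cells of the unit cube (`volume_heightRegion`).

An order cell has volume equal to its number of linear extensions over (n-1)!
(`factorial_mul_volume_orderCell`), and the linear extensions for p are the standard tableaux of its
strip (`numTableaux_strip`). -/

/-! ### Counting elements below a threshold -/

/-- The number of elements of `S` that are smaller than `i`. -/
def countBelow {n : ℕ} (S : Finset (Fin n)) (i : ℕ) : ℕ :=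
  (S.filter fun k : Fin n => (k : ℕ) < i).card

theorem countBelow_zero {n : ℕ} (S : Finset (Fin n)) : countBelow S 0 = 0 := by
  simp [countBelow]

theorem countBelow_succ {n : ℕ} (S : Finset (Fin n)) (k : Fin n) :
    countBelow S (k + 1) = countBelow S k + if k ∈ S then 1 else 0 := by
  have h : S.filter (fun j : Fin n => (j : ℕ) < k + 1) =
      S.filter (fun j : Fin n => (j : ℕ) < k) ∪ if k ∈ S then {k} else ∅ := by
    ext j
    split_ifs with hk
    · simp only [Finset.mem_filter, Finset.mem_union, Finset.mem_singleton, Fin.ext_iff]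
      constructor
      · rintro ⟨h1, h2⟩
        by_cases h3 : (j : ℕ) = k
        · exact Or.inr h3
        · exact Or.inl ⟨h1, by omega⟩
      · rintro (⟨h1, h2⟩ | h)
        · exact ⟨h1, by omega⟩
        · have : j = k := Fin.ext h
          subst this
          exact ⟨hk, by omega⟩
    · simp only [Finset.mem_filter, Finset.union_empty]
      constructor
      · rintro ⟨h1, h2⟩
        have : j ≠ k := fun h => hk (h ▸ h1)
        exact ⟨h1, by have := Fin.val_ne_of_ne this; omega⟩
      · rintro ⟨h1, h2⟩
        exact ⟨h1, by omega⟩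
  unfold countBelow
  rw [h, Finset.card_union_of_disjoint]
  · split_ifs <;> simp
  · split_ifs <;> simp

theorem countBelow_of_le {n : ℕ} (S : Finset (Fin n)) {i : ℕ} (hi : n ≤ i) :
    countBelow S i = S.card := by
  unfold countBelow
  rw [Finset.filter_true_of_mem]
  intro k _
  omega

/-- For a strictly increasing `g`, exactly the first `#{j | g j < i}` values are below `i`. -/
theorem lt_card_filter_iff {n r : ℕ} (g : Fin r → Fin n) (hg : StrictMono g) (i : ℕ) (j : Fin r) :
    (j : ℕ) < (Finset.univ.filter fun j' : Fin r => (g j' : ℕ) < i).card ↔ (g j : ℕ) < i := by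
  constructor
  · intro h
    by_contra hij
    have hsub : (Finset.univ.filter fun j' : Fin r => (g j' : ℕ) < i) ⊆ Finset.Iio j := by
      intro j' hj'
      simp only [Finset.mem_filter, Finset.mem_univ, true_and] at hj'
      rw [Finset.mem_Iio]
      by_contra hle
      have := hg.monotone (not_lt.1 hle)
      rw [Fin.le_def] at this
      omega
    have := Finset.card_le_card hsub
    rw [Fin.card_Iio] at this
    omega
  · intro h
    have hsub : Finset.Iic j ⊆ (Finset.univ.filter fun j' : Fin r => (g j' : ℕ) < i) := by
      intro j' hj'
      rw [Finset.mem_Iic] at hj'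
      have := hg.monotone hj'
      rw [Fin.le_def] at this
      simp only [Finset.mem_filter, Finset.mem_univ, true_and]
      omega
    have := Finset.card_le_card hsub
    rw [Fin.card_Iic] at this
    omega

theorem card_filter_orderEmbOfFin {n r : ℕ} (S : Finset (Fin n)) (hS : S.card = r) (i : ℕ) :
    (Finset.univ.filter fun j => (S.orderEmbOfFin hS j : ℕ) < i).card = countBelow S i := by
  unfold countBelow
  rw [← Finset.card_map (S.orderEmbOfFin hS).toEmbedding]
  congr 1
  ext k
  simp only [Finset.mem_map, Finset.mem_filter, Finset.mem_univ, true_and, RelEmbedding.coe_toEmbedding]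
  constructor
  · rintro ⟨j, hj, rfl⟩
    exact ⟨Finset.orderEmbOfFin_mem S hS j, hj⟩
  · rintro ⟨hk, hki⟩
    have : k ∈ Set.range (S.orderEmbOfFin hS) := by
      rw [Finset.range_orderEmbOfFin]; exact hk
    obtain ⟨j, rfl⟩ := this
    exact ⟨j, hki, rfl⟩

theorem lt_countBelow_iff {n r : ℕ} (S : Finset (Fin n)) (hS : S.card = r) (i : ℕ) (j : Fin r) :
    (j : ℕ) < countBelow S i ↔ (S.orderEmbOfFin hS j : ℕ) < i := by
  rw [← card_filter_orderEmbOfFin S hS, lt_card_filter_iff _ (S.orderEmbOfFin hS).strictMono]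

/-! ### Letter counts of lattice paths -/

namespace LatticePath

variable {m r : ℕ} (P Q : LatticePath m r)

theorem count_N_eq_countBelow (i : ℕ) :
    P.count Step.N i = countBelow (Finset.univ.filter fun k => P.1 k = Step.N) i := by
  unfold count countBelow
  rw [Finset.filter_filter]
  congr 1
  ext k
  simp [and_comm]

theorem count_N_zero : P.count Step.N 0 = 0 := by simp [count]

theorem count_N_succ (k : Fin (m + r)) :
    P.count Step.N (k + 1) = P.count Step.N k + if P.1 k = Step.N then 1 else 0 := by
  simp [count_N_eq_countBelow, countBelow_succ]

theorem count_N_last : P.count Step.N (m + r) = r := by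
  rw [count_N_eq_countBelow, countBelow_of_le _ le_rfl, P.2]

theorem count_E_add_count_N {i : ℕ} (hi : i ≤ m + r) :
    P.count Step.E i + P.count Step.N i = i := by
  unfold count
  rw [← Finset.card_union_of_disjoint]
  · have : (Finset.univ.filter fun k : Fin (m + r) => (k : ℕ) < i ∧ P.1 k = Step.E) ∪
        (Finset.univ.filter fun k : Fin (m + r) => (k : ℕ) < i ∧ P.1 k = Step.N) =
        Finset.univ.filter fun k : Fin (m + r) => (k : ℕ) < i := by
      ext k
      cases h : P.1 k <;> simp [h]
    rw [this, Fin.card_filter_val_lt]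
    omega
  · rw [Finset.disjoint_left]
    intro k h1 h2
    simp only [Finset.mem_filter, Finset.mem_univ, true_and] at h1 h2
    rw [h1.2] at h2
    exact absurd h2.2 (by decide)

theorem count_N_le_succ {i : ℕ} (hi : i < m + r) :
    P.count Step.N i ≤ P.count Step.N (i + 1) ∧ P.count Step.N (i + 1) ≤ P.count Step.N i + 1 := by
  have := P.count_N_succ ⟨i, hi⟩
  simp only at this
  rw [this]
  split_ifs <;> omega

theorem count_N_mono {i j : ℕ} (hij : i ≤ j) : P.count Step.N i ≤ P.count Step.N j := by
  unfold count
  refine Finset.card_le_card fun k hk => ?_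
  simp only [Finset.mem_filter, Finset.mem_univ, true_and] at hk ⊢
  exact ⟨by omega, hk.2⟩

theorem count_E_mono {i j : ℕ} (hij : i ≤ j) : P.count Step.E i ≤ P.count Step.E j := by
  unfold count
  refine Finset.card_le_card fun k hk => ?_
  simp only [Finset.mem_filter, Finset.mem_univ, true_and] at hk ⊢
  exact ⟨by omega, hk.2⟩

theorem count_E_last : P.count Step.E (m + r) = m := by
  have h1 := P.count_E_add_count_N le_rfl
  have h2 := P.count_N_last
  omega

/-- Positions of North steps and heights are inverse descriptions of a path; this exchanges the
bounds `l_j`, `u_j` for inequalities between heights. -/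
theorem northStep_lt_iff (j : Fin r) (i : ℕ) :
    (P.northStep j : ℕ) < i ↔ (j : ℕ) < P.count Step.N i := by
  rw [count_N_eq_countBelow, lt_countBelow_iff _ P.2]
  rfl

theorem card_northStep_lt (i : ℕ) :
    (Finset.univ.filter fun j => (P.northStep j : ℕ) < i).card = P.count Step.N i := by
  rw [count_N_eq_countBelow, ← card_filter_orderEmbOfFin _ P.2]
  rfl

/-- A sequence that starts at `0`, ends at `r` and has increments `0` and `1` is the height
sequence of a lattice path. -/
theorem exists_count_N_eq (c : ℕ → ℕ) (h0 : c 0 = 0) (hr : c (m + r) = r)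
    (hc : ∀ i < m + r, c (i + 1) = c i ∨ c (i + 1) = c i + 1) :
    ∃ P : LatticePath m r, ∀ i ≤ m + r, P.count Step.N i = c i := by
  classical
  let S : Finset (Fin (m + r)) := Finset.univ.filter fun k => c (k + 1) = c k + 1
  have hS : ∀ i ≤ m + r, countBelow S i = c i := by
    intro i hi
    induction i with
    | zero => rw [countBelow_zero, h0]
    | succ i ih =>
      have := countBelow_succ S ⟨i, hi⟩
      simp only [S, Finset.mem_filter, Finset.mem_univ, true_and] at this
      have h1 := ih (by omega)
      have h2 := hc i hi
      simp only [S] at h1 ⊢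
      rw [this, h1]
      split_ifs <;> omega
  have hw : (Finset.univ.filter fun k => (if k ∈ S then Step.N else Step.E) = Step.N) = S := by
    ext k
    by_cases hk : k ∈ S <;> simp [hk]
  have hcard : (Finset.univ.filter fun k => (if k ∈ S then Step.N else Step.E) = Step.N).card = r := by
    rw [hw, ← countBelow_of_le S le_rfl, hS _ le_rfl, hr]
  let R : LatticePath m r := ⟨fun k => if k ∈ S then Step.N else Step.E, hcard⟩
  refine ⟨R, fun i hi => ?_⟩
  have hR : (Finset.univ.filter fun k => R.1 k = Step.N) = S := hw
  rw [count_N_eq_countBelow, hR, hS i hi]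

theorem ext_count_N {P Q : LatticePath m r}
    (h : ∀ i ≤ m + r, P.count Step.N i = Q.count Step.N i) : P = Q := by
  apply Subtype.ext
  funext k
  have h1 := P.count_N_succ k
  have h2 := Q.count_N_succ k
  rw [h _ (by omega), h _ (by omega), h2] at h1
  cases hP : P.1 k <;> cases hQ : Q.1 k <;> simp [hP, hQ] at h1 ⊢

end LatticePath

/-! ### Bases of lattice path matroids -/

theorem transversalMatroid_indep_iff {α ι : Type*} [Finite α] (A : ι → Set α) (I : Set α) :
    (transversalMatroid A).Indep I ↔ IsPartialTransversal A I := by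
  exact Iff.rfl

theorem IsPartialTransversal.ncard_le {α : Type*} [Finite α] {r : ℕ} {A : Fin r → Set α}
    {I : Set α} (h : IsPartialTransversal A I) : I.ncard ≤ r := by
  obtain ⟨f, hf, -⟩ := h
  have := Nat.card_le_card_of_injective f hf
  simpa [Nat.card_coe_set_eq] using this

/-- No partial transversal exceeds r elements, so the full one `I` shows that the rank is r; bases
are then the independent sets of that size. -/
theorem transversalMatroid_isBase_iff {α : Type*} [Finite α] {r : ℕ} {A : Fin r → Set α}
    {I : Set α} (hI : IsPartialTransversal A I) (hIr : I.ncard = r) (B : Set α) :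
    (transversalMatroid A).IsBase B ↔ IsPartialTransversal A B ∧ B.ncard = r := by
  obtain ⟨B', hB', hIB'⟩ := ((transversalMatroid_indep_iff A I).2 hI).exists_isBase_superset
  have hB'r : B'.ncard = r := le_antisymm
    ((transversalMatroid_indep_iff A B').1 hB'.indep).ncard_le
    (hIr ▸ Set.ncard_le_ncard hIB' (Set.toFinite _))
  constructor
  · intro hB
    exact ⟨(transversalMatroid_indep_iff A B).1 hB.indep,
      (hB.ncard_eq_ncard_of_isBase hB').trans hB'r⟩
  · rintro ⟨hB, hBr⟩
    obtain ⟨B'', hB'', hsub⟩ := ((transversalMatroid_indep_iff A B).2 hB).exists_isBase_superset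
    have : B = B'' := Set.eq_of_subset_of_ncard_le hsub
      (by rw [hBr, ← hB'r, hB''.ncard_eq_ncard_of_isBase hB']) (Set.toFinite _)
    rwa [this]

/-- A set of positions is a full transversal of the intervals between the North steps of `Q` and
`P` exactly when the path with these North steps lies between `P` and `Q`. -/
theorem isPartialTransversal_Icc_iff {m r : ℕ} (P Q : LatticePath m r) (S : Finset (Fin (m + r)))
    (hS : S.card = r) :
    IsPartialTransversal (fun j : Fin r => Set.Icc (Q.northStep j) (P.northStep j))
        (S : Set (Fin (m + r))) ↔
      ∀ i, P.count Step.N i ≤ countBelow S i ∧ countBelow S i ≤ Q.count Step.N i := by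
  constructor
  · rintro ⟨f, hf, hA⟩ i
    have hbij : Function.Bijective f := by
      rw [Fintype.bijective_iff_injective_and_card]
      exact ⟨hf, by simp [hS]⟩
    have hcard : countBelow S i =
        (Finset.univ.filter fun x : (S : Set (Fin (m + r))) => (x.1 : ℕ) < i).card := by
      unfold countBelow
      refine (Finset.card_bij (fun (x : (S : Set (Fin (m + r)))) _ => x.1) ?_ ?_ ?_).symm
      · intro x hx
        simp only [Finset.mem_filter, Finset.mem_univ, true_and] at hx ⊢
        exact ⟨x.2, hx⟩
      · intro x _ y _ h
        exact Subtype.ext h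
      · intro k hk
        simp only [Finset.mem_filter] at hk
        exact ⟨⟨k, hk.1⟩, by simpa using hk.2, rfl⟩
    -- If `u_j < i`, the element matched to j is also below i; if x is below i, so is the left end
    -- of its interval.
    rw [hcard, ← P.card_northStep_lt, ← Q.card_northStep_lt]
    constructor
    · refine Finset.card_le_card_of_surjOn f ?_
      intro j hj
      simp only [Finset.coe_filter, Finset.mem_univ, true_and, Set.mem_ofPred_eq] at hj
      obtain ⟨x, rfl⟩ := hbij.2 j
      refine ⟨x, ?_, rfl⟩
      have := (hA x).2
      rw [Fin.le_def] at this
      simp only [Finset.coe_filter, Finset.mem_univ, true_and, Set.mem_ofPred_eq]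
      omega
    · refine Finset.card_le_card_of_injOn f ?_ hf.injOn
      intro x hx
      simp only [Finset.coe_filter, Finset.mem_univ, true_and, Set.mem_ofPred_eq] at hx ⊢
      have := (hA x).1
      rw [Fin.le_def] at this
      omega
  · intro h
    -- Conversely, the increasing matching works: the j-th element of `S` goes to the j-th interval.
    let g := S.orderIsoOfFin hS
    refine ⟨g.symm, g.symm.injective, ?_⟩
    intro x
    obtain ⟨j, rfl⟩ := g.surjective x
    rw [OrderIso.symm_apply_apply]
    have hg : ((g j : Fin (m + r)) : ℕ) = S.orderEmbOfFin hS j := rfl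
    constructor
    · rw [Fin.le_def]
      have h1 := (lt_countBelow_iff S hS ((g j : Fin (m + r)) + 1) j).2 (by omega)
      have h2 := (Q.northStep_lt_iff j ((g j : Fin (m + r)) + 1)).2
        (lt_of_lt_of_le h1 (h _).2)
      omega
    · rw [Fin.le_def]
      have h1 := (P.northStep_lt_iff j (P.northStep j + 1)).1 (by omega)
      have h2 := (lt_countBelow_iff S hS (P.northStep j + 1) j).1 (lt_of_lt_of_le h1 (h _).1)
      omega

theorem latticePathMatroid_isBase_iff {m r : ℕ} {P Q : LatticePath m r} (hPQ : P.NeverAbove Q)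
    (S : Finset (Fin (m + r))) :
    (latticePathMatroid P Q).IsBase (S : Set (Fin (m + r))) ↔
      S.card = r ∧ ∀ i ≤ m + r, P.count Step.N i ≤ countBelow S i ∧
        countBelow S i ≤ Q.count Step.N i := by
  have hext : ∀ S : Finset (Fin (m + r)), S.card = r →
      ((∀ i ≤ m + r, P.count Step.N i ≤ countBelow S i ∧ countBelow S i ≤ Q.count Step.N i) ↔
      ∀ i, P.count Step.N i ≤ countBelow S i ∧ countBelow S i ≤ Q.count Step.N i) := by
    intro S hS
    refine ⟨fun h i => ?_, fun h i _ => h i⟩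
    rcases le_or_gt i (m + r) with hi | hi
    · exact h i hi
    · rw [P.count_N_eq_countBelow, Q.count_N_eq_countBelow, countBelow_of_le _ hi.le,
        countBelow_of_le _ hi.le, countBelow_of_le _ hi.le, P.2, Q.2, hS]
      exact ⟨le_rfl, le_rfl⟩
  -- The North steps of `P` are a full transversal, so the rank is r.
  have hP := (isPartialTransversal_Icc_iff P Q _ P.2).2 ((hext _ P.2).1 fun i hi => by
    rw [← P.count_N_eq_countBelow]
    exact ⟨le_rfl, hPQ i hi⟩)
  rw [latticePathMatroid, transversalMatroid_isBase_iff hP (by rw [Set.ncard_coe_finset, P.2]),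
    Set.ncard_coe_finset, and_comm]
  refine and_congr_right fun hS => ?_
  rw [isPartialTransversal_Icc_iff P Q S hS, hext S hS]

/-! ### The inequalities that define the polytope -/

/-- The sum of the first `i` coordinates. -/
def partialSum {n : ℕ} (x : Fin n → ℝ) (i : ℕ) : ℝ :=
  ∑ k ∈ Finset.univ.filter fun k : Fin n => (k : ℕ) < i, x k

theorem partialSum_zero {n : ℕ} (x : Fin n → ℝ) : partialSum x 0 = 0 := by
  simp [partialSum]

theorem partialSum_succ {n : ℕ} (x : Fin n → ℝ) (k : Fin n) :
    partialSum x (k + 1) = partialSum x k + x k := by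
  have h : (Finset.univ.filter fun j : Fin n => (j : ℕ) < k + 1) =
      insert k (Finset.univ.filter fun j : Fin n => (j : ℕ) < k) := by
    ext j
    simp only [Finset.mem_filter, Finset.mem_univ, true_and, Finset.mem_insert, Fin.ext_iff]
    omega
  rw [partialSum, h, Finset.sum_insert (by simp), add_comm]
  rfl

theorem partialSum_indicator {n : ℕ} (S : Finset (Fin n)) (i : ℕ) :
    partialSum (Set.indicator (S : Set (Fin n)) 1) i = countBelow S i := by
  have : S.filter (fun k : Fin n => (k : ℕ) < i) =
      (Finset.univ.filter fun k : Fin n => (k : ℕ) < i).filter fun k => k ∈ S := by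
    ext k
    simp [and_comm]
  rw [partialSum, countBelow, this, Finset.card_filter]
  simp [Set.indicator_apply]

/-- The points of the unit cube all of whose partial sums lie between the heights of `P` and
of `Q`. -/
def pathPolytope {m r : ℕ} (P Q : LatticePath m r) : Set (Fin (m + r) → ℝ) :=
  {x | (∀ k, x k ∈ Set.Icc (0 : ℝ) 1) ∧ ∀ i ≤ m + r,
    partialSum x i ∈ Set.Icc (P.count Step.N i : ℝ) (Q.count Step.N i)}

theorem partialSum_combo {n : ℕ} (x y : Fin n → ℝ) (a b : ℝ) (i : ℕ) :
    partialSum (a • x + b • y) i = a * partialSum x i + b * partialSum y i := by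
  simp [partialSum, Finset.sum_add_distrib, Finset.mul_sum]

theorem convex_pathPolytope {m r : ℕ} (P Q : LatticePath m r) : Convex ℝ (pathPolytope P Q) := by
  intro x hx y hy a b ha hb hab
  refine ⟨fun k => ?_, fun i hi => ?_⟩
  · exact convex_Icc (0 : ℝ) 1 (hx.1 k) (hy.1 k) ha hb hab
  · rw [partialSum_combo]
    exact convex_Icc _ _ (hx.2 i hi) (hy.2 i hi) ha hb hab

theorem ceil_sub_eq {a s : ℝ} (hs : s ∈ Set.Ico (0 : ℝ) 1) :
    (⌈a - s⌉ : ℝ) = ⌊a⌋ + Set.indicator (Set.Iio (Int.fract a)) 1 s := by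
  have h0 := Int.fract_nonneg a
  have h1 := Int.fract_lt_one a
  have h2 := Int.floor_add_fract a
  by_cases h : s < Int.fract a
  · have : ⌈a - s⌉ = ⌊a⌋ + 1 := by
      rw [Int.ceil_eq_iff]
      push_cast
      constructor <;> linarith [hs.1]
    rw [this, Set.indicator_of_mem (show s ∈ Set.Iio (Int.fract a) from h)]
    simp
  · have : ⌈a - s⌉ = ⌊a⌋ := by
      rw [Int.ceil_eq_iff]
      constructor <;> linarith [hs.2]
    rw [this, Set.indicator_of_notMem (show s ∉ Set.Iio (Int.fract a) from h)]
    simp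

instance isProbabilityMeasure_restrict_Ico :
    IsProbabilityMeasure (volume.restrict (Set.Ico (0 : ℝ) 1)) :=
  ⟨by simp⟩

theorem integrable_ceil_sub (a : ℝ) :
    Integrable (fun s : ℝ => (⌈a - s⌉ : ℝ)) (volume.restrict (Set.Ico (0 : ℝ) 1)) := by
  have h : Integrable (fun s : ℝ => (⌊a⌋ : ℝ) + Set.indicator (Set.Iio (Int.fract a)) 1 s)
      (volume.restrict (Set.Ico (0 : ℝ) 1)) :=
    (integrable_const _).add ((integrable_const (1 : ℝ)).indicator measurableSet_Iio)
  refine h.congr ?_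
  filter_upwards [ae_restrict_mem measurableSet_Ico] with s hs
  rw [ceil_sub_eq hs]

/-- A real number is the average of its roundings. -/
theorem integral_ceil_sub (a : ℝ) : ∫ s in Set.Ico (0 : ℝ) 1, (⌈a - s⌉ : ℝ) = a := by
  rw [setIntegral_congr_fun measurableSet_Ico fun s hs => ceil_sub_eq hs,
    integral_add (g := Set.indicator (Set.Iio (Int.fract a)) 1) (integrable_const _)
      ((integrable_const (1 : ℝ)).indicator measurableSet_Iio),
    integral_indicator measurableSet_Iio, Measure.restrict_restrict measurableSet_Iio]
  have : Set.Iio (Int.fract a) ∩ Set.Ico (0 : ℝ) 1 = Set.Ico 0 (Int.fract a) := by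
    ext s
    have := Int.fract_lt_one a
    simp only [Set.mem_inter_iff, Set.mem_Iio, Set.mem_Ico]
    constructor
    · rintro ⟨h1, h2, -⟩
      exact ⟨h2, h1⟩
    · rintro ⟨h1, h2⟩
      exact ⟨h2, h1, h2.trans this⟩
  rw [this]
  simp [Int.fract_nonneg, measureReal_def]

theorem matroidPolytope_subset {m r : ℕ} {P Q : LatticePath m r} (hPQ : P.NeverAbove Q) :
    matroidPolytope (latticePathMatroid P Q) ⊆ pathPolytope P Q := by
  classical
  refine convexHull_min ?_ (convex_pathPolytope P Q)
  rintro x ⟨B, hB, rfl⟩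
  obtain ⟨S, rfl⟩ : ∃ S : Finset (Fin (m + r)), B = S := ⟨B.toFinset, by simp⟩
  obtain ⟨-, h⟩ := (latticePathMatroid_isBase_iff hPQ S).1 hB
  refine ⟨fun k => ?_, fun i hi => ?_⟩
  · by_cases hk : k ∈ S <;> simp [hk]
  · rw [partialSum_indicator]
    exact ⟨Nat.cast_le.2 (h i hi).1, Nat.cast_le.2 (h i hi).2⟩

/-- Rounding the partial sums of a point of the polytope gives a base. -/
theorem ceil_sub_mem_incidenceVectors {m r : ℕ} {P Q : LatticePath m r} (hPQ : P.NeverAbove Q)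
    {x : Fin (m + r) → ℝ} (hx : x ∈ pathPolytope P Q) {s : ℝ} (hs : s ∈ Set.Ico (0 : ℝ) 1) :
    ∃ B, (latticePathMatroid P Q).IsBase B ∧
      (fun k : Fin (m + r) => (⌈partialSum x (k + 1) - s⌉ : ℝ) - ⌈partialSum x k - s⌉) =
        Set.indicator B 1 := by
  classical
  -- The threshold s is the same for all partial sums, so an increment in [0,1] rounds to 0 or 1.
  have hstep : ∀ k : Fin (m + r), ⌈partialSum x (k + 1) - s⌉ = ⌈partialSum x k - s⌉ ∨
      ⌈partialSum x (k + 1) - s⌉ = ⌈partialSum x k - s⌉ + 1 := by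
    intro k
    have h1 : ⌈partialSum x k - s⌉ ≤ ⌈partialSum x (k + 1) - s⌉ := by
      apply Int.ceil_mono
      rw [partialSum_succ]
      linarith [(hx.1 k).1]
    have h2 : ⌈partialSum x (k + 1) - s⌉ ≤ ⌈partialSum x k - s⌉ + 1 := by
      rw [← Int.ceil_add_one]
      apply Int.ceil_mono
      rw [partialSum_succ]
      linarith [(hx.1 k).2]
    omega
  let S : Finset (Fin (m + r)) := Finset.univ.filter fun k =>
    ⌈partialSum x (k + 1) - s⌉ = ⌈partialSum x k - s⌉ + 1
  have hcount : ∀ i ≤ m + r, (countBelow S i : ℤ) = ⌈partialSum x i - s⌉ := by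
    intro i hi
    induction i with
    | zero =>
      rw [countBelow_zero, partialSum_zero, eq_comm, Int.ceil_eq_iff]
      push_cast
      constructor <;> linarith [hs.1, hs.2]
    | succ i ih =>
      have h1 := countBelow_succ S ⟨i, hi⟩
      have h2 := ih (by omega)
      have h3 := hstep ⟨i, hi⟩
      simp only [S, Finset.mem_filter, Finset.mem_univ, true_and] at h1 h2 h3 ⊢
      rw [h1]
      push_cast
      rw [h2]
      split_ifs <;> omega
  -- Rounding respects integer bounds: from below because s < 1, from above because s ≥ 0.
  have hbound : ∀ i ≤ m + r, P.count Step.N i ≤ countBelow S i ∧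
      countBelow S i ≤ Q.count Step.N i := by
    intro i hi
    obtain ⟨h1, h2⟩ := hx.2 i hi
    constructor
    · rw [← Nat.cast_le (α := ℤ), hcount i hi]
      rw [← Int.sub_one_lt_iff, Int.lt_ceil]
      push_cast
      linarith [hs.2]
    · rw [← Nat.cast_le (α := ℤ), hcount i hi, Int.ceil_le]
      push_cast
      linarith [hs.1]
  refine ⟨S, (latticePathMatroid_isBase_iff hPQ S).2 ⟨?_, hbound⟩, ?_⟩
  · have h1 := hbound _ le_rfl
    rw [P.count_N_last, Q.count_N_last, countBelow_of_le S le_rfl] at h1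
    omega
  · funext k
    rcases hstep k with h | h
    · have : k ∉ (S : Set (Fin (m + r))) := by simp [S, h]
      rw [Set.indicator_of_notMem this, h, sub_self]
    · have : k ∈ (S : Set (Fin (m + r))) := by simp [S, h]
      rw [Set.indicator_of_mem this, h]
      simp

/-- A convex hull of finitely many points is closed, so it contains the average over s of the
rounded vertices, which is x. -/
theorem matroidPolytope_latticePathMatroid {m r : ℕ} {P Q : LatticePath m r}
    (hPQ : P.NeverAbove Q) :
    matroidPolytope (latticePathMatroid P Q) = pathPolytope P Q := by
  refine (matroidPolytope_subset hPQ).antisymm fun x hx => ?_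
  have hfin : {x : Fin (m + r) → ℝ | ∃ B, (latticePathMatroid P Q).IsBase B ∧
      x = Set.indicator B 1}.Finite := by
    refine (Set.finite_range fun B : Set (Fin (m + r)) =>
      (Set.indicator B 1 : Fin (m + r) → ℝ)).subset ?_
    rintro _ ⟨B, -, rfl⟩
    exact ⟨B, rfl⟩
  have hint : ∀ k : Fin (m + r), Integrable
      (fun s : ℝ => (⌈partialSum x (k + 1) - s⌉ : ℝ) - ⌈partialSum x k - s⌉)
      (volume.restrict (Set.Ico (0 : ℝ) 1)) := fun k =>
    (integrable_ceil_sub _).sub (integrable_ceil_sub _)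
  have hmem := (convex_convexHull ℝ _).integral_mem (hfin.isClosed_convexHull ℝ)
    (μ := volume.restrict (Set.Ico (0 : ℝ) 1))
    (f := fun s (k : Fin (m + r)) => (⌈partialSum x (k + 1) - s⌉ : ℝ) - ⌈partialSum x k - s⌉)
    (by
      filter_upwards [ae_restrict_mem measurableSet_Ico] with s hs
      exact subset_convexHull ℝ _ (ceil_sub_mem_incidenceVectors hPQ hx hs))
    (Integrable.of_eval hint)
  have hx' : ∫ s in Set.Ico (0 : ℝ) 1, (fun k : Fin (m + r) =>
      (⌈partialSum x (k + 1) - s⌉ : ℝ) - ⌈partialSum x k - s⌉) = x := by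
    funext k
    rw [eval_integral hint k, integral_sub (integrable_ceil_sub _) (integrable_ceil_sub _),
      integral_ceil_sub, integral_ceil_sub, partialSum_succ, add_sub_cancel_left]
  rwa [hx'] at hmem

/-! ### Volumes of order cells of the cube -/

/-- The points of the open unit cube whose coordinates satisfy the strict inequalities prescribed
by `rel`. -/
def orderCell {N : ℕ} (rel : Fin N → Fin N → Prop) : Set (Fin N → ℝ) :=
  {t | (∀ i, t i ∈ Set.Ioo (0 : ℝ) 1) ∧ ∀ i j, rel i j → t i < t j}

theorem measurableSet_orderCell {N : ℕ} (rel : Fin N → Fin N → Prop) :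
    MeasurableSet (orderCell rel) := by
  have : orderCell rel = (⋂ i, {t : Fin N → ℝ | t i ∈ Set.Ioo (0 : ℝ) 1}) ∩
      ⋂ i, ⋂ j, ⋂ _ : rel i j, {t : Fin N → ℝ | t i < t j} := by
    ext t
    simp [orderCell]
  rw [this]
  refine (MeasurableSet.iInter fun i => measurable_pi_apply i measurableSet_Ioo).inter ?_
  exact MeasurableSet.iInter fun i => MeasurableSet.iInter fun j => MeasurableSet.iInter fun _ =>
    measurableSet_lt (measurable_pi_apply i) (measurable_pi_apply j)

theorem volume_sub_eq_zero {N : ℕ} {i j : Fin N} (hij : i ≠ j) (c : ℝ) :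
    volume {t : Fin N → ℝ | t i - t j = c} = 0 := by
  have hp : ({t : Fin N → ℝ | t i - t j = c} : Set (Fin N → ℝ)) =
      ((AffineSubspace.mk' (fun k => if k = i then c else 0)
        (LinearMap.ker ((LinearMap.proj i : (Fin N → ℝ) →ₗ[ℝ] ℝ) - LinearMap.proj j))) :
        Set (Fin N → ℝ)) := by
    ext t
    simp only [Set.mem_ofPred_eq, SetLike.mem_coe, AffineSubspace.mem_mk', LinearMap.mem_ker,
      vsub_eq_sub, LinearMap.sub_apply, LinearMap.proj_apply, Pi.sub_apply, if_true,
      if_neg hij.symm]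
    constructor <;> intro h <;> linarith
  rw [hp]
  apply Measure.addHaar_affineSubspace
  intro h
  have h2 : (fun k => if k = i then c + 1 else 0 : Fin N → ℝ) ∈ ({t | t i - t j = c} : Set _) := by
    rw [hp, h]
    trivial
  simp only [Set.mem_ofPred_eq, if_true, if_neg hij.symm] at h2
  linarith

theorem volume_eval_eq_zero {N : ℕ} (i : Fin N) (c : ℝ) :
    volume {t : Fin N → ℝ | t i = c} = 0 :=
  Measure.pi_hyperplane (fun _ : Fin N => (volume : Measure ℝ)) i c

theorem volume_not_injective {N : ℕ} :
    volume {t : Fin N → ℝ | ¬ Function.Injective t} = 0 := by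
  have : {t : Fin N → ℝ | ¬ Function.Injective t} ⊆
      ⋃ i, ⋃ j, ⋃ _ : i ≠ j, {t : Fin N → ℝ | t i - t j = 0} := by
    intro t ht
    simp only [Set.mem_ofPred_eq, Function.Injective, not_forall] at ht
    obtain ⟨i, j, h, hij⟩ := ht
    simp only [Set.mem_iUnion]
    exact ⟨i, j, hij, sub_eq_zero.2 h⟩
  refine measure_mono_null this ?_
  simp only [measure_iUnion_null_iff]
  intro i j hij
  exact volume_sub_eq_zero hij 0

theorem exists_perm_lt_iff {N : ℕ} {t : Fin N → ℝ} (ht : Function.Injective t) :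
    ∃ σ : Equiv.Perm (Fin N), ∀ i j, σ i < σ j ↔ t i < t j := by
  have hs : StrictMono (t ∘ Tuple.sort t) :=
    (Tuple.monotone_sort t).strictMono_of_injective (ht.comp (Tuple.sort t).injective)
  -- `Tuple.sort` sends a rank to an index; the inverse sends an index to its rank.
  refine ⟨(Tuple.sort t)⁻¹, fun i j => ?_⟩
  rw [← hs.lt_iff_lt]
  simp

/-- The only increasing permutation of `Fin N` is the identity; apply this to τ ∘ σ⁻¹. -/
theorem perm_eq_of_lt_imp {N : ℕ} {σ τ : Equiv.Perm (Fin N)}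
    (h : ∀ i j, σ i < σ j → τ i < τ j) : σ = τ := by
  have hs : StrictMono (fun i => τ (σ.symm i)) := by
    intro i j hij
    exact h _ _ (by simpa using hij)
  have : (fun i => τ (σ.symm i)) = id := by
    have h1 : Set.range (fun i => τ (σ.symm i)) = Set.range (id : Fin N → Fin N) := by
      rw [Set.range_id]
      exact Set.range_eq_univ.2 (τ.surjective.comp σ.symm.surjective)
    exact (StrictMono.range_inj hs strictMono_id).1 h1
  ext i
  have h2 := congrFun this (σ i)
  simp only [Equiv.symm_apply_apply, id] at h2
  rw [h2]

theorem disjoint_orderCell_perm {N : ℕ} {σ τ : Equiv.Perm (Fin N)} (h : σ ≠ τ) :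
    Disjoint (orderCell fun i j => σ i < σ j) (orderCell fun i j => τ i < τ j) := by
  rw [Set.disjoint_left]
  rintro t ⟨-, ht⟩ ⟨-, ht'⟩
  refine h (perm_eq_of_lt_imp fun i j hij => ?_)
  by_contra hle
  rcases (not_lt.1 hle).lt_or_eq with hlt | heq
  · exact lt_asymm (ht _ _ hij) (ht' _ _ hlt)
  · rw [τ.injective heq] at hij
    exact lt_irrefl _ hij

theorem volume_orderCell_perm_eq {N : ℕ} (σ : Equiv.Perm (Fin N)) :
    volume (orderCell fun i j => σ i < σ j) = volume (orderCell fun i j : Fin N => i < j) := by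
  have h := volume_measurePreserving_piCongrLeft (fun _ : Fin N => ℝ) σ.symm
  rw [← h.measure_preimage (measurableSet_orderCell _).nullMeasurableSet]
  congr 1
  ext t
  have hval : ∀ i, MeasurableEquiv.piCongrLeft (fun _ : Fin N => ℝ) σ.symm t i = t (σ i) := by
    intro i
    have := MeasurableEquiv.piCongrLeft_apply_apply (β := fun _ : Fin N => ℝ) (e := σ.symm) t (σ i)
    simpa using this
  simp only [orderCell, Set.mem_preimage, Set.mem_ofPred_eq, hval]
  constructor
  · rintro ⟨h1, h2⟩
    refine ⟨fun i => by simpa using h1 (σ.symm i), fun i j hij => ?_⟩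
    simpa using h2 (σ.symm i) (σ.symm j) (by simpa using hij)
  · rintro ⟨h1, h2⟩
    exact ⟨fun i => h1 _, fun i j hij => h2 _ _ hij⟩

open Classical in
-- A point of the cell with distinct coordinates lies in the simplex of exactly one permutation, its
-- ranking, which is a linear extension of `rel`. All simplices have the same volume, and
-- coincidences of coordinates are null.
theorem volume_orderCell_eq_sum {N : ℕ} (rel : Fin N → Fin N → Prop) :
    volume (orderCell rel) =
      (Finset.univ.filter fun σ : Equiv.Perm (Fin N) => ∀ i j, rel i j → σ i < σ j).card *
        volume (orderCell fun i j : Fin N => i < j) := by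
  set F := Finset.univ.filter fun σ : Equiv.Perm (Fin N) => ∀ i j, rel i j → σ i < σ j with hF
  have hU : volume (⋃ σ ∈ F, orderCell fun i j => σ i < σ j) =
      F.card * volume (orderCell fun i j : Fin N => i < j) := by
    rw [measure_biUnion_finset (fun σ _ τ _ h => disjoint_orderCell_perm h)
      (fun σ _ => measurableSet_orderCell _)]
    simp [volume_orderCell_perm_eq]
  rw [← hU]
  refine le_antisymm ?_ (measure_mono ?_)
  · have hsub : orderCell rel ⊆ (⋃ σ ∈ F, orderCell fun i j => σ i < σ j) ∪
        {t | ¬ Function.Injective t} := by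
      rintro t ⟨h1, h2⟩
      by_cases ht : Function.Injective t
      · obtain ⟨σ, hσ⟩ := exists_perm_lt_iff ht
        refine Or.inl ?_
        simp only [Set.mem_iUnion]
        refine ⟨σ, ?_, h1, fun i j hij => (hσ i j).1 hij⟩
        simp only [hF, Finset.mem_filter, Finset.mem_univ, true_and]
        exact fun i j hij => (hσ i j).2 (h2 i j hij)
      · exact Or.inr ht
    refine (measure_mono hsub).trans ((measure_union_le _ _).trans ?_)
    rw [volume_not_injective, add_zero]
  · intro t ht
    simp only [Set.mem_iUnion] at ht
    obtain ⟨σ, hσ, h1, h2⟩ := ht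
    simp only [hF, Finset.mem_filter, Finset.mem_univ, true_and] at hσ
    exact ⟨h1, fun i j hij => h2 i j (hσ i j hij)⟩

open Classical in
/-- The volume of an order polytope is the proportion of linear extensions among all orderings. -/
theorem factorial_mul_volume_orderCell {N : ℕ} (rel : Fin N → Fin N → Prop) :
    N.factorial * volume (orderCell rel) =
      (Finset.univ.filter fun σ : Equiv.Perm (Fin N) => ∀ i j, rel i j → σ i < σ j).card := by
  -- The empty relation calibrates the simplex: the cube, of volume 1, consists of N! of them.
  have hcube : volume (orderCell fun _ _ : Fin N => False) = 1 := by
    have : (orderCell fun _ _ : Fin N => False) = Set.univ.pi fun _ => Set.Ioo (0 : ℝ) 1 := by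
      ext t
      simp [orderCell]
    rw [this, volume_pi_pi]
    simp
  have h1 := volume_orderCell_eq_sum (fun _ _ : Fin N => False)
  rw [hcube] at h1
  simp only [false_imp_iff, implies_true, Finset.filter_true, Finset.card_univ, Fintype.card_perm,
    Fintype.card_fin] at h1
  rw [volume_orderCell_eq_sum rel, mul_left_comm, ← h1, mul_one]

/-! ### Standard tableaux of the strip of a path -/

/-- The inequalities between the entries of consecutive boxes of the strip of `p`: entries
increase along East steps and decrease along North steps. The boxes are numbered by `Fin N`. -/
def stepRel {a b : ℕ} (p : LatticePath a b) (N : ℕ) (i j : Fin N) : Prop :=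
  ((j : ℕ) = i + 1 ∧ p.count Step.N j = p.count Step.N i) ∨
    ((i : ℕ) = j + 1 ∧ p.count Step.N i = p.count Step.N j + 1)

namespace LatticePath

variable {a b : ℕ} (p : LatticePath a b)

theorem vertex_injOn : Set.InjOn p.vertex (Set.Iic (a + b)) := by
  intro i hi j hj h
  rw [Set.mem_Iic] at hi hj
  have h1 := p.count_E_add_count_N hi
  have h2 := p.count_E_add_count_N hj
  simp only [vertex, Prod.mk.injEq] at h
  omega

/-- The boxes of the strip of `p` in the order in which `p` visits them. -/
noncomputable def stripEquiv : Fin (a + b + 1) ≃ strip p :=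
  Equiv.ofBijective
    (fun i => ⟨p.vertex i, Finset.mem_image_of_mem _ (Finset.mem_range.2 i.2)⟩)
    (by
      constructor
      · intro i j h
        refine Fin.ext (p.vertex_injOn ?_ ?_ (Subtype.ext_iff.1 h))
        · simp only [Set.mem_Iic]; omega
        · simp only [Set.mem_Iic]; omega
      · rintro ⟨c, hc⟩
        obtain ⟨i, hi, rfl⟩ := Finset.mem_image.1 hc
        exact ⟨⟨i, Finset.mem_range.1 hi⟩, rfl⟩)

theorem stripEquiv_apply (i : Fin (a + b + 1)) : (stripEquiv p i : ℕ × ℕ) = p.vertex i := rfl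

theorem card_strip : (strip p).card = a + b + 1 := by
  rw [← Fintype.card_coe, ← Fintype.card_congr (stripEquiv p), Fintype.card_fin]

/-- Heights are monotone, so the boxes of a row are visited consecutively and the comparison is a
chain of East step comparisons. -/
theorem lt_of_row_aux (g : Fin (a + b + 1) → ℕ)
    (hg : ∀ i j, stepRel p _ i j → g i < g j) (i : Fin (a + b + 1)) (d : ℕ)
    (hd : (i : ℕ) + (d + 1) < a + b + 1)
    (hrow : p.count Step.N (i + (d + 1)) = p.count Step.N i) : g i < g ⟨i + (d + 1), hd⟩ := by
  induction d with
  | zero => exact hg _ _ (Or.inl ⟨rfl, hrow⟩)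
  | succ d ih =>
    have h1 : p.count Step.N (i + (d + 1)) = p.count Step.N i := by
      have h1 := p.count_N_mono (show (i : ℕ) ≤ i + (d + 1) by omega)
      have h2 := p.count_N_mono (show (i : ℕ) + (d + 1) ≤ i + (d + 1 + 1) by omega)
      omega
    refine (ih (by omega) h1).trans (hg _ _ (Or.inl ⟨?_, ?_⟩))
    · simp only; omega
    · simp only; omega

theorem lt_of_column_aux (g : Fin (a + b + 1) → ℕ)
    (hg : ∀ i j, stepRel p _ i j → g i < g j) (i : Fin (a + b + 1)) (d : ℕ)
    (hd : (i : ℕ) + (d + 1) < a + b + 1)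
    (hcol : p.count Step.E (i + (d + 1)) = p.count Step.E i) : g ⟨i + (d + 1), hd⟩ < g i := by
  -- Between two boxes of one column there is no East step, so every step raises the height.
  have key : ∀ e ≤ d + 1, p.count Step.N (i + e) = p.count Step.N i + e := by
    intro e he
    have h1 := p.count_E_mono (show (i : ℕ) ≤ i + e by omega)
    have h2 := p.count_E_mono (show (i : ℕ) + e ≤ i + (d + 1) by omega)
    have h3 := p.count_E_add_count_N (show (i : ℕ) ≤ a + b by omega)
    have h4 := p.count_E_add_count_N (show (i : ℕ) + e ≤ a + b by omega)
    omega
  clear hcol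
  induction d with
  | zero => exact hg _ _ (Or.inr ⟨rfl, key 1 le_rfl⟩)
  | succ d ih =>
    refine (hg _ _ (Or.inr ⟨?_, ?_⟩)).trans (ih (by omega) fun e he => key e (by omega))
    · simp only; omega
    · have h1 := key (d + 1) (by omega)
      have h2 := key (d + 1 + 1) (by omega)
      simp only; omega

/-- A filling of the strip is standard if and only if it is a bijection with the right
inequalities between consecutive boxes. -/
theorem isStandardTableau_strip_iff (T : strip p → ℕ) :
    IsStandardTableau (strip p) T ↔ Set.BijOn T Set.univ (Set.Icc 1 (a + b + 1)) ∧
      ∀ i j, stepRel p _ i j → T (stripEquiv p i) < T (stripEquiv p j) := by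
  rw [IsStandardTableau, card_strip]
  refine and_congr_right fun _ => ⟨?_, ?_⟩
  · rintro ⟨hrow, hcol⟩ i j hij
    have hi := p.count_E_add_count_N (show (i : ℕ) ≤ a + b by omega)
    have hj := p.count_E_add_count_N (show (j : ℕ) ≤ a + b by omega)
    rcases hij with ⟨h1, h2⟩ | ⟨h1, h2⟩
    · refine hrow _ _ ?_ ?_
      · simp only [stripEquiv_apply, vertex]; omega
      · simp only [stripEquiv_apply, vertex]; omega
    · refine hcol _ _ ?_ ?_
      · simp only [stripEquiv_apply, vertex]; omega
      · simp only [stripEquiv_apply, vertex]; omega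
  · intro h
    have hlt : ∀ i j : Fin (a + b + 1), (i : ℕ) < j →
        ∃ d, ∃ hd : (i : ℕ) + (d + 1) < a + b + 1, j = ⟨i + (d + 1), hd⟩ := fun i j hij =>
      ⟨j - i - 1, by omega, Fin.ext (by simp only; omega)⟩
    constructor
    · intro c d h1 h2
      obtain ⟨i, rfl⟩ := (stripEquiv p).surjective c
      obtain ⟨j, rfl⟩ := (stripEquiv p).surjective d
      simp only [stripEquiv_apply, vertex] at h1 h2
      have hij : (i : ℕ) < j := by
        by_contra hle
        have := p.count_E_mono (not_lt.1 hle)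
        omega
      obtain ⟨d, hd, rfl⟩ := hlt i j hij
      exact p.lt_of_row_aux (fun i => T (stripEquiv p i)) h i d hd h1.symm
    · intro c d h1 h2
      obtain ⟨i, rfl⟩ := (stripEquiv p).surjective c
      obtain ⟨j, rfl⟩ := (stripEquiv p).surjective d
      simp only [stripEquiv_apply, vertex] at h1 h2
      have hij : (i : ℕ) < j := by
        by_contra hle
        have := p.count_N_mono (not_lt.1 hle)
        omega
      obtain ⟨d, hd, rfl⟩ := hlt i j hij
      exact p.lt_of_column_aux (fun i => T (stripEquiv p i)) h i d hd h1.symm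

open Classical in
-- Number the boxes along `p`; a permutation, shifted by 1 because entries start at 1, becomes a
-- filling.
theorem numTableaux_strip :
    numTableaux (strip p) = (Finset.univ.filter fun σ : Equiv.Perm (Fin (a + b + 1)) =>
      ∀ i j, stepRel p _ i j → σ i < σ j).card := by
  rw [numTableaux, ← Set.ncard_coe_finset]
  symm
  refine Set.ncard_congr (fun σ _ c => (σ ((stripEquiv p).symm c) : ℕ) + 1) ?_ ?_ ?_
  · intro σ hσ
    simp only [Finset.coe_filter, Finset.mem_univ, true_and, Set.mem_ofPred_eq] at hσ
    refine (p.isStandardTableau_strip_iff _).2 ⟨⟨?_, ?_, ?_⟩, ?_⟩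
    · intro c _
      simp only [Set.mem_Icc]
      omega
    · intro c _ d _ h
      simp only [add_left_inj] at h
      exact (stripEquiv p).symm.injective (σ.injective (Fin.ext h))
    · intro k hk
      rw [Set.mem_Icc] at hk
      refine ⟨stripEquiv p (σ.symm ⟨k - 1, by omega⟩), trivial, ?_⟩
      simp only [Equiv.symm_apply_apply, Equiv.apply_symm_apply]
      omega
    · intro i j hij
      have := hσ i j hij
      rw [Fin.lt_def] at this
      simp only [Equiv.symm_apply_apply]
      omega
  · intro σ τ _ _ h
    ext i
    have := congrFun h (stripEquiv p i)
    simpa using this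
  · intro T hT
    obtain ⟨hbij, hlt⟩ := (p.isStandardTableau_strip_iff T).1 hT
    have hmem : ∀ c, 1 ≤ T c ∧ T c ≤ a + b + 1 := fun c => hbij.mapsTo (Set.mem_univ c)
    let f : Fin (a + b + 1) → Fin (a + b + 1) := fun i =>
      ⟨T (stripEquiv p i) - 1, by have := hmem (stripEquiv p i); omega⟩
    have hf : Function.Injective f := by
      intro i j h
      have h1 := hmem (stripEquiv p i)
      have h2 := hmem (stripEquiv p j)
      have h3 : T (stripEquiv p i) - 1 = T (stripEquiv p j) - 1 := congrArg Fin.val h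
      exact (stripEquiv p).injective (hbij.injOn trivial trivial (by omega))
    refine ⟨Equiv.ofBijective f (Finite.injective_iff_bijective.1 hf), ?_, ?_⟩
    · simp only [Finset.coe_filter, Finset.mem_univ, true_and, Set.mem_ofPred_eq]
      intro i j hij
      have h1 := hmem (stripEquiv p i)
      have h3 := hlt i j hij
      rw [Fin.lt_def]
      simp only [Equiv.ofBijective_apply, f]
      omega
    · funext c
      have := hmem c
      simp only [Equiv.ofBijective_apply, f, Equiv.apply_symm_apply]
      omega

end LatticePath

/-! ### Paths of boxes in the region -/

/-- Only the lower right corner against `P` and the upper left one against `Q` matter, both on the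
antidiagonal `c.1 + c.2 + 1`: heights change by at most 1 per step, which settles the other corners.
-/
theorem mem_region_iff {m r : ℕ} (P Q : LatticePath m r) (c : ℕ × ℕ) :
    c ∈ region P Q ↔ c.1 + c.2 + 2 ≤ m + r ∧ P.count Step.N (c.1 + c.2 + 1) ≤ c.2 ∧
      c.2 + 1 ≤ Q.count Step.N (c.1 + c.2 + 1) := by
  obtain ⟨a, b⟩ := c
  have e1 : a + 1 + b = a + b + 1 := by omega
  have e2 : a + (b + 1) = a + b + 1 := by omega
  have e3 : a + 1 + (b + 1) = a + b + 1 + 1 := by omega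
  simp only [region, PointBetween, Set.mem_ofPred_eq, e1, e2, e3]
  constructor
  · rintro ⟨-, h2, h3, h4⟩
    exact ⟨h4.1, h2.2.1, h3.2.2⟩
  · rintro ⟨h1, h2, h3⟩
    have hP0 := P.count_N_le_succ (show a + b < m + r by omega)
    have hP1 := P.count_N_le_succ (show a + b + 1 < m + r by omega)
    have hQ0 := Q.count_N_le_succ (show a + b < m + r by omega)
    have hQ1 := Q.count_N_le_succ (show a + b + 1 < m + r by omega)
    omega

theorem mem_pathsInRegion_iff {m r : ℕ} (hm : 0 < m) (hr : 0 < r) (P Q : LatticePath m r)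
    (p : LatticePath (m - 1) (r - 1)) :
    p ∈ pathsInRegion P Q ↔ ∀ i < m + r - 1, P.count Step.N (i + 1) ≤ p.count Step.N i ∧
      p.count Step.N i + 1 ≤ Q.count Step.N (i + 1) := by
  have hv : ∀ i < m + r - 1, (p.vertex i).1 + (p.vertex i).2 = i := fun i hi =>
    p.count_E_add_count_N (by omega)
  simp only [pathsInRegion, Finset.mem_filter, Finset.mem_univ, true_and, strip,
    Finset.forall_mem_image, Finset.mem_range, mem_region_iff]
  have hN : m - 1 + (r - 1) + 1 = m + r - 1 := by omega
  rw [hN]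
  refine forall_congr' fun i => forall_congr' fun hi => ?_
  rw [hv i hi]
  simp only [vertex]
  constructor
  · exact fun h => h.2
  · exact fun h => ⟨by omega, h⟩

theorem region_eq_empty {m r : ℕ} (P Q : LatticePath m r) (h : m = 0 ∨ r = 0) :
    region P Q = ∅ := by
  rw [Set.eq_empty_iff_forall_notMem]
  rintro ⟨a, b⟩ hc
  obtain ⟨h1, h2, h3⟩ := (mem_region_iff P Q _).1 hc
  simp only at h1 h2 h3
  rcases h with rfl | rfl
  · have h4 := P.count_E_add_count_N (show a + b + 1 ≤ 0 + r by omega)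
    have h5 := P.count_E_mono (show a + b + 1 ≤ 0 + r by omega)
    rw [P.count_E_last] at h5
    omega
  · have h5 := Q.count_N_mono (show a + b + 1 ≤ m + 0 by omega)
    rw [Q.count_N_last] at h5
    omega

theorem isBorderStrip_empty : IsBorderStrip ∅ :=
  ⟨fun x => x.2.elim, fun ⟨_, _, h, _⟩ => h⟩

/-! ### The polytope in partial sum coordinates -/

/-- The partial sums (except the first and the last one) of the points of the polytope. -/
def heightRegion {m r : ℕ} (P Q : LatticePath m r) : Set (Fin (m + r - 1) → ℝ) :=
  {y | ∃ Y : ℕ → ℝ, (∀ i : Fin (m + r - 1), Y (i + 1) = y i) ∧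
    (∀ k < m + r, Y (k + 1) - Y k ∈ Set.Icc (0 : ℝ) 1) ∧
    ∀ i ≤ m + r, Y i ∈ Set.Icc (P.count Step.N i : ℝ) (Q.count Step.N i)}

/-- The linear map that sends a point to its sequence of partial sums. -/
def partialSumMap (N : ℕ) : (Fin N → ℝ) →ₗ[ℝ] (Fin N → ℝ) :=
  Matrix.toLin' (Matrix.of fun i j : Fin N => if j ≤ i then (1 : ℝ) else 0)

theorem partialSumMap_apply {N : ℕ} (z : Fin N → ℝ) (i : Fin N) :
    partialSumMap N z i = partialSum z (i + 1) := by
  simp only [partialSumMap, Matrix.toLin'_apply, Matrix.mulVec, dotProduct, Matrix.of_apply,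
    ite_mul, one_mul, zero_mul, partialSum, Finset.sum_filter, Fin.le_def, Nat.lt_succ_iff]

/-- The matrix is lower triangular with ones on the diagonal. -/
theorem det_partialSumMap (N : ℕ) : LinearMap.det (partialSumMap N) = 1 := by
  rw [partialSumMap, LinearMap.det_toLin', Matrix.det_of_isLowerTriangular]
  · simp
  · intro i j hij
    have : ¬ j ≤ i := not_le.2 hij
    simp [this]

theorem volume_preimage_partialSumMap {N : ℕ} (S : Set (Fin N → ℝ)) :
    volume (partialSumMap N ⁻¹' S) = volume S := by
  rw [Measure.addHaar_preimage_linearMap volume (by rw [det_partialSumMap]; exact one_ne_zero),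
    det_partialSumMap]
  simp

/-- The heights of `P` and `Q` agree at both ends, which pins `Y` to 0 and r there; differences of
`Y` then recover every coordinate, the forgotten one included. -/
theorem forgetLast_image_pathPolytope {m r : ℕ} (hn : 0 < m + r) (P Q : LatticePath m r) :
    forgetLast '' pathPolytope P Q = partialSumMap (m + r - 1) ⁻¹' heightRegion P Q := by
  ext z
  constructor
  · rintro ⟨x, hx, rfl⟩
    refine ⟨partialSum x, fun i => ?_, fun k hk => ?_, hx.2⟩
    · rw [partialSumMap_apply]
      have key : ∀ j ≤ m + r - 1, partialSum x j = partialSum (forgetLast x) j := by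
        intro j hj
        induction j with
        | zero => rw [partialSum_zero, partialSum_zero]
        | succ j ih =>
          have h1 := partialSum_succ x ⟨j, by omega⟩
          have h2 := partialSum_succ (forgetLast x) ⟨j, hj⟩
          simp only at h1 h2
          rw [h1, h2, ih (by omega)]
          rfl
      exact key _ (by omega)
    · have := partialSum_succ x ⟨k, hk⟩
      simp only at this
      rw [this, add_sub_cancel_left]
      exact hx.1 _
  · rintro ⟨Y, hYz, hstep, hbd⟩
    have h0 : Y 0 = 0 := by
      have := hbd 0 (Nat.zero_le _)
      rw [P.count_N_zero, Q.count_N_zero] at this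
      exact le_antisymm (by simpa using this.2) (by simpa using this.1)
    let x : Fin (m + r) → ℝ := fun k => Y (k + 1) - Y k
    have hx : ∀ i ≤ m + r, partialSum x i = Y i := by
      intro i hi
      induction i with
      | zero => rw [partialSum_zero, h0]
      | succ i ih =>
        have h1 := partialSum_succ x ⟨i, hi⟩
        simp only [x] at h1 ih ⊢
        rw [h1, ih (by omega)]
        ring
    refine ⟨x, ⟨fun k => hstep k k.2, fun i hi => ?_⟩, ?_⟩
    · rw [hx i hi]
      exact hbd i hi
    · have hz : ∀ i ≤ m + r - 1, Y i = partialSum z i := by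
        intro i hi
        cases i with
        | zero => rw [h0, partialSum_zero]
        | succ i => rw [← partialSumMap_apply z ⟨i, hi⟩, ← hYz ⟨i, hi⟩]
      funext i
      have h1 := partialSum_succ z i
      simp only [forgetLast, x, Fin.val_castLE]
      rw [hz _ (by omega), hz _ (by omega), h1, add_sub_cancel_left]

/-! ### Decomposition into translated order cells -/

/-- The points whose integer parts are the heights of `p` and whose fractional parts satisfy the
inequalities prescribed by the steps of `p`. -/
def pathCell {a b : ℕ} (p : LatticePath a b) (N : ℕ) : Set (Fin N → ℝ) :=
  (fun y => y + fun i : Fin N => -(p.count Step.N i : ℝ)) ⁻¹' orderCell (stepRel p N)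

theorem mem_pathCell_iff {a b : ℕ} {p : LatticePath a b} {N : ℕ} {y : Fin N → ℝ} :
    y ∈ pathCell p N ↔ (∀ i : Fin N, (p.count Step.N i : ℝ) < y i ∧
      y i < p.count Step.N i + 1) ∧
      ∀ i j, stepRel p N i j → y i - p.count Step.N i < y j - p.count Step.N j := by
  simp only [pathCell, orderCell, Set.mem_preimage, Set.mem_ofPred_eq, Pi.add_apply,
    Set.mem_Ioo, ← sub_eq_add_neg, sub_pos, sub_lt_iff_lt_add']

theorem measurableSet_pathCell {a b : ℕ} (p : LatticePath a b) (N : ℕ) :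
    MeasurableSet (pathCell p N) :=
  (measurable_id.add_const _) (measurableSet_orderCell _)

theorem volume_pathCell {a b : ℕ} (p : LatticePath a b) (N : ℕ) :
    volume (pathCell p N) = volume (orderCell (stepRel p N)) :=
  measure_preimage_add_right _ _ _

theorem factorial_mul_volume_pathCell {a b N : ℕ} (p : LatticePath a b) (hN : N = a + b + 1) :
    N.factorial * volume (pathCell p N) = numTableaux (strip p) := by
  subst hN
  rw [volume_pathCell, factorial_mul_volume_orderCell, p.numTableaux_strip]

/-- The integer parts of a point of the cell are all the heights of its path, so they determine the
path. -/
theorem disjoint_pathCell {a b N : ℕ} (hN : N = a + b + 1) {p q : LatticePath a b} (h : p ≠ q) :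
    Disjoint (pathCell p N) (pathCell q N) := by
  rw [Set.disjoint_left]
  intro y hp hq
  refine h (ext_count_N fun i hi => ?_)
  obtain ⟨hp1, hp2⟩ := (mem_pathCell_iff.1 hp).1 ⟨i, by omega⟩
  obtain ⟨hq1, hq2⟩ := (mem_pathCell_iff.1 hq).1 ⟨i, by omega⟩
  have h1 : p.count Step.N i < q.count Step.N i + 1 := by exact_mod_cast hp1.trans hq2
  have h2 : q.count Step.N i < p.count Step.N i + 1 := by exact_mod_cast hq1.trans hp2
  omega

theorem pathCell_subset_heightRegion {m r : ℕ} (hm : 0 < m) (hr : 0 < r) {P Q : LatticePath m r}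
    {p : LatticePath (m - 1) (r - 1)} (hp : p ∈ pathsInRegion P Q) :
    pathCell p (m + r - 1) ⊆ heightRegion P Q := by
  intro y hy
  rw [mem_pathsInRegion_iff hm hr] at hp
  obtain ⟨hfl, hrel⟩ := mem_pathCell_iff.1 hy
  -- `Y` is `y` shifted by one, with the forced end values 0 and r; values past `m + r` play no
  -- role.
  let Y : ℕ → ℝ := fun k => if k = 0 then 0 else
    if h : k - 1 < m + r - 1 then y ⟨k - 1, h⟩ else r
  have hY0 : Y 0 = 0 := rfl
  have hYr : Y (m + r) = r := by
    simp only [Y]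
    rw [if_neg (by omega), dif_neg (by omega)]
  have hYs : ∀ (i : ℕ) (hi : i < m + r - 1), Y (i + 1) = y ⟨i, hi⟩ := by
    intro i hi
    simp only [Y]
    rw [if_neg (by omega), dif_pos (by omega)]
    simp
  refine ⟨Y, fun i => hYs i i.2, fun k hk => ?_, fun i hi => ?_⟩
  · rcases Nat.eq_zero_or_pos k with rfl | hk0
    · have h1 := hfl ⟨0, by omega⟩
      simp only [p.count_N_zero, Nat.cast_zero, zero_add] at h1
      rw [hYs 0 (by omega), hY0, sub_zero]
      exact ⟨h1.1.le, h1.2.le⟩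
    obtain ⟨k, rfl⟩ : ∃ j, k = j + 1 := ⟨k - 1, by omega⟩
    rcases Nat.lt_or_ge (k + 1) (m + r - 1) with h | h
    · rw [hYs (k + 1) h, hYs k (by omega)]
      have h1 := hfl ⟨k, by omega⟩
      have h2 := hfl ⟨k + 1, h⟩
      have h3 := hrel ⟨k, by omega⟩ ⟨k + 1, h⟩
      have h4 := hrel ⟨k + 1, h⟩ ⟨k, by omega⟩
      have h5 := p.count_N_le_succ (show k < m - 1 + (r - 1) by omega)
      simp only at h1 h2 h3 h4
      -- East: same integer part, larger fraction. North: integer part one higher, smaller fraction.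
      -- Either way the increment is in (0,1).
      rcases (show p.count Step.N (k + 1) = p.count Step.N k ∨
        p.count Step.N (k + 1) = p.count Step.N k + 1 by omega) with h6 | h6
      · have h7 := h3 (Or.inl ⟨rfl, h6⟩)
        rw [h6] at h2 h7
        constructor <;> linarith
      · have h7 := h4 (Or.inr ⟨rfl, h6⟩)
        rw [h6] at h2 h7
        push_cast at h2 h7
        constructor <;> linarith
    -- The last box has height r - 1, so the last entry of `y` lies within 1 below r.
    · have hk' : k + 1 + 1 = m + r := by omega
      have h1 := hfl ⟨k, by omega⟩
      have h2 := p.count_N_last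
      have h3 : m - 1 + (r - 1) = k := by omega
      rw [h3] at h2
      simp only [h2, Nat.cast_pred hr] at h1
      rw [hk', hYr, hYs k (by omega)]
      constructor <;> linarith
  · rcases Nat.eq_zero_or_pos i with rfl | hi0
    · simp [hY0, P.count_N_zero, Q.count_N_zero]
    obtain ⟨i, rfl⟩ : ∃ j, i = j + 1 := ⟨i - 1, by omega⟩
    rcases Nat.lt_or_ge i (m + r - 1) with h | h
    · rw [hYs i h]
      have h1 := hfl ⟨i, h⟩
      have h2 := hp i h
      simp only at h1
      have h3 : (P.count Step.N (i + 1) : ℝ) ≤ p.count Step.N i := by exact_mod_cast h2.1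
      have h4 : (p.count Step.N i : ℝ) + 1 ≤ Q.count Step.N (i + 1) := by exact_mod_cast h2.2
      constructor <;> linarith
    · have h' : i + 1 = m + r := by omega
      rw [h', hYr, P.count_N_last, Q.count_N_last]
      exact ⟨le_rfl, le_rfl⟩

/-- A sequence of heights with no accidental integrality lies in the cell of its path of integer
parts. -/
theorem exists_mem_pathCell {m r : ℕ} (hm : 0 < m) (hr : 0 < r) {P Q : LatticePath m r}
    {y : Fin (m + r - 1) → ℝ} (hy : y ∈ heightRegion P Q) (h1 : ∀ i, ∀ c : ℕ, y i ≠ c)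
    (h2 : ∀ i j, i ≠ j → ∀ c : ℕ, y i - y j ≠ c) :
    ∃ p ∈ pathsInRegion P Q, y ∈ pathCell p (m + r - 1) := by
  obtain ⟨Y, hYs, hstep, hbd⟩ := hy
  have hYs' : ∀ (i : ℕ) (hi : i < m + r - 1), Y (i + 1) = y ⟨i, hi⟩ := fun i hi => hYs ⟨i, hi⟩
  have hpos : ∀ i ≤ m + r, 0 ≤ Y i := fun i hi => (Nat.cast_nonneg _).trans (hbd i hi).1
  have hfl : ∀ i < m + r - 1, (⌊Y (i + 1)⌋₊ : ℝ) < Y (i + 1) ∧ Y (i + 1) < ⌊Y (i + 1)⌋₊ + 1 :=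
    fun i hi => ⟨lt_of_le_of_ne (Nat.floor_le (hpos _ (by omega)))
      (by rw [hYs' i hi]; exact (h1 _ _).symm), Nat.lt_floor_add_one _⟩
  -- Non-integral differences make the increments strictly between 0 and 1.
  have hd : ∀ i, (hi : i + 1 < m + r - 1) → Y (i + 1) < Y (i + 1 + 1) ∧
      Y (i + 1 + 1) < Y (i + 1) + 1 := by
    intro i hi
    have h3 := hstep (i + 1) (by omega)
    have h4 := h2 ⟨i + 1, hi⟩ ⟨i, by omega⟩ (by simp)
    rw [← hYs' _ hi, ← hYs' i (by omega)] at h4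
    have h5 := lt_of_le_of_ne h3.1 (by simpa using (h4 0).symm)
    have h6 := lt_of_le_of_ne h3.2 (by simpa using h4 1)
    constructor <;> linarith
  obtain ⟨p, hp⟩ := exists_count_N_eq (m := m - 1) (r := r - 1) (fun i => ⌊Y (i + 1)⌋₊)
    (by
      have h3 := hstep 0 (by omega)
      have h4 := (hbd 0 (by omega)).2
      have h5 := h1 ⟨0, by omega⟩ 1
      rw [Q.count_N_zero] at h4
      rw [← hYs' 0 (by omega)] at h5
      rw [Nat.floor_eq_zero]
      refine lt_of_le_of_ne ?_ (by simpa using h5)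
      have := h3.2
      push_cast at h4
      linarith)
    (by
      have e1 : m - 1 + (r - 1) + 1 + 1 = m + r := by omega
      have h3 := hstep (m - 1 + (r - 1) + 1) (by omega)
      have h4 := hbd (m + r) le_rfl
      rw [P.count_N_last, Q.count_N_last] at h4
      rw [e1] at h3
      have h5 := h1 ⟨m - 1 + (r - 1), by omega⟩ r
      rw [← hYs' _ (by omega)] at h5
      rw [Nat.floor_eq_iff (hpos _ (by omega)), Nat.cast_pred hr]
      have h6 : Y (m - 1 + (r - 1) + 1) < r := lt_of_le_of_ne (by linarith [h3.1, h4.2]) h5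
      exact ⟨by linarith [h3.2, h4.1], by linarith⟩)
    (by
      intro i hi
      obtain ⟨h3, h4⟩ := hd i (by omega)
      have h5 := Nat.floor_mono h3.le
      have h6 := Nat.floor_mono h4.le
      rw [Nat.floor_add_one (hpos _ (by omega))] at h6
      omega)
  have hp' : ∀ i < m + r - 1, p.count Step.N i = ⌊Y (i + 1)⌋₊ := fun i hi => hp i (by omega)
  refine ⟨p, (mem_pathsInRegion_iff hm hr P Q p).2 fun i hi => ?_,
    mem_pathCell_iff.2 ⟨fun i => ?_, fun i j hij => ?_⟩⟩
  · obtain ⟨h3, h4⟩ := hbd (i + 1) (by omega)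
    -- Since `y` avoids integers, the bound by `Q` is strict; this gives the extra 1 needed for the
    -- top of the box.
    have h5 := h1 ⟨i, hi⟩ (Q.count Step.N (i + 1))
    rw [← hYs' i hi] at h5
    rw [hp' i hi]
    exact ⟨Nat.le_floor h3, (Nat.floor_lt (hpos _ (by omega))).2 (lt_of_le_of_ne h4 h5)⟩
  · rw [hp' i i.2, ← hYs i]
    exact hfl i i.2
  · rw [← hYs i, ← hYs j]
    -- With equal floors the fraction rises with `Y`; when the floor rises by 1 while `Y` rises by
    -- less, the fraction drops.
    rcases hij with ⟨h3, h4⟩ | ⟨h3, h4⟩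
    · rw [h4, h3]
      linarith [(hd i (by omega)).1]
    · rw [h4, h3]
      push_cast
      linarith [(hd j (by omega)).2]

theorem volume_heightRegion {m r : ℕ} (hm : 0 < m) (hr : 0 < r) (P Q : LatticePath m r) :
    volume (heightRegion P Q) = ∑ p ∈ pathsInRegion P Q, volume (pathCell p (m + r - 1)) := by
  rw [← measure_biUnion_finset (fun p _ q _ h => disjoint_pathCell (by omega) h)
    fun p _ => measurableSet_pathCell p _]
  refine le_antisymm ?_ (measure_mono (Set.iUnion₂_subset fun p hp =>
    pathCell_subset_heightRegion hm hr hp))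
  -- The points outside all cells lie on countably many hyperplanes.
  have hsub : heightRegion P Q ⊆ (⋃ p ∈ pathsInRegion P Q, pathCell p (m + r - 1)) ∪
      ((⋃ i, ⋃ c : ℕ, {y | y i = c}) ∪ ⋃ i, ⋃ j, ⋃ _ : i ≠ j, ⋃ c : ℕ, {y | y i - y j = c}) := by
    intro y hy
    by_cases h1 : ∀ i, ∀ c : ℕ, y i ≠ c
    · by_cases h2 : ∀ i j, i ≠ j → ∀ c : ℕ, y i - y j ≠ c
      · obtain ⟨p, hp, hyp⟩ := exists_mem_pathCell hm hr hy h1 h2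
        exact Or.inl (Set.mem_iUnion₂.2 ⟨p, hp, hyp⟩)
      · push Not at h2
        obtain ⟨i, j, hij, c, hc⟩ := h2
        refine Or.inr (Or.inr ?_)
        simp only [Set.mem_iUnion]
        exact ⟨i, j, hij, c, hc⟩
    · push Not at h1
      obtain ⟨i, c, hc⟩ := h1
      refine Or.inr (Or.inl ?_)
      simp only [Set.mem_iUnion]
      exact ⟨i, c, hc⟩
  refine (measure_mono hsub).trans ((measure_union_le _ _).trans ?_)
  rw [measure_union_null, add_zero]
  · simp only [measure_iUnion_null_iff]
    exact fun i c => volume_eval_eq_zero i c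
  · simp only [measure_iUnion_null_iff]
    exact fun i j hij c => volume_sub_eq_zero hij c

theorem normalizedVolume_matroidPolytope {m r : ℕ} (hm : 0 < m) (hr : 0 < r)
    {P Q : LatticePath m r} (hPQ : P.NeverAbove Q) :
    normalizedVolume (matroidPolytope (latticePathMatroid P Q)) =
      ((∑ p ∈ pathsInRegion P Q, numTableaux (strip p) : ℕ) : ENNReal) := by
  rw [normalizedVolume, matroidPolytope_latticePathMatroid hPQ,
    forgetLast_image_pathPolytope (by omega), volume_preimage_partialSumMap,
    volume_heightRegion hm hr, Finset.mul_sum, Nat.cast_sum]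
  exact Finset.sum_congr rfl fun p _ => factorial_mul_volume_pathCell p (by omega)

end LPM

theorem mainTheorem2 (m r : ℕ) (P Q : LPM.LatticePath m r) (hPQ : P.NeverAbove Q)
    (hconn : LPM.IsConnected (LPM.latticePathMatroid P Q))
    (hstrip : ¬ LPM.IsBorderStripMatroid P Q) :
    LPM.normalizedVolume (LPM.matroidPolytope (LPM.latticePathMatroid P Q)) =
      ((∑ p ∈ LPM.pathsInRegion P Q, LPM.numTableaux (LPM.strip p) : ℕ) : ENNReal) := by
  -- With m = 0 or r = 0 the region would be empty, hence a border strip. Excluding this makes `m -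
  -- 1` and `r - 1` genuine differences.
  have hmr : ¬ (m = 0 ∨ r = 0) := fun h => hstrip ⟨hconn, by
    rw [LPM.region_eq_empty P Q h]
    exact LPM.isBorderStrip_empty⟩
  exact LPM.normalizedVolume_matroidPolytope (by omega) (by omega) hPQ
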